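/- All tournaments are finite. A tournament is a loopless directed graph in which, for any two distinct vertices $v,w$, exactly one of $(v,w)$, $(w,v)$ is an edge; it is transitive if it contains no directed cycle. A tournament $T$ is $S$-free if no subtournament of $T$ is isomorphic to $S$. For a tournament $T$ write $|T|$ for its number of vertices, $T|X$ for the subtournament induced by $X\subseteq V(T)$, and $tr(T)$ for the largest number of vertices of a transitive subtournament of $T$. For $\epsilon>0$, $T$ is $\epsilon$-critical if $tr(T)<|T|^{\epsilon}$ but $tr(T')\ge |T'|^{\epsilon}$ for every proper subtournament $T'$ of $T$. For nonempty disjoint $X,Y\subseteq V(T)$ let $d(X,Y)=\frac{e_{X,Y}}{|X||Y|}$, where $e_{X,Y}$ is the number of edges $(x,y)$ with $x\in X$, $y\in Y$. Let $c>0$, $0<\lambda<1$, and let $w=(w_1,\dots,w_k)$ be a $\{0,1\}$-vector. A sequence $(A_1,\dots,A_k)$ of pairwise disjoint subsets of $V(T)$ is a $(c,\lambda,w)$-structure in $T$ if $|A_i|\ge c|T|$ whenever $w_i=0$; $T|A_i$ is transitive and $|A_i|\ge c\cdot tr(T)$ whenever $w_i=1$; and $d(A_i,A_j)\ge 1-\lambda$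 for all $1\le i<j\le k$. It is smooth if moreover, for all $i<j$, $d(\{v\},A_j)\ge 1-\lambda$ for every $v\in A_i$ and $d(A_i,\{v\})\ge 1-\lambda$ for every $v\in A_j$. **Theorem.** Let $S$ be a tournament, let $w$ be a $\{0,1\}$-vector, and let $0<\lambda_1<\frac12$. Then there exist $\epsilon_1,c_1>0$ such that for every $0<\epsilon<\epsilon_1$, every $S$-free $\epsilon$-critical tournament contains a smooth $(c_1,\lambda_1,w)$-structure. -/

import Mathlib

/-- A tournament on the vertex set `V`: a loopless digraph in which, for any two distinct vertices
`v`, `w`, exactly one of the edges `(v, w)`, `(w, v)` is present. -/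
structure Tournament (V : Type*) extends Digraph V where
  loopless : ∀ v, ¬ Adj v v
  exactly_one : ∀ v w, v ≠ w → Xor (Adj v w) (Adj w v)

namespace Tournament

/-- The subtournament `T|X` induced by a set `X` of vertices. -/
def induce {V : Type*} (T : Tournament V) (X : Finset V) : Tournament X where
  Adj v w := T.Adj v w
  loopless v := T.loopless v
  exactly_one v w h := T.exactly_one v w (fun e => h (Subtype.ext e))

/-- A tournament is transitive if it has no directed cycle: no vertex can be reached from itself
along a nonempty directed walk. -/
def IsTransitive {V : Type*} (T : Tournament V) : Prop :=
  ∀ v, ¬ Relation.TransGen T.Adj v v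

/-- `T` contains `H` as a subtournament (up to isomorphism). -/
def Contains {V W : Type*} (T : Tournament V) (H : Tournament W) : Prop :=
  Nonempty (H.Adj ↪r T.Adj)

/-- `T` is `H`-free. -/
def IsFree {V W : Type*} (T : Tournament V) (H : Tournament W) : Prop :=
  ¬ T.Contains H

open Classical in
/-- `tr T`: the largest number of vertices of a transitive subtournament of `T`. -/
noncomputable def tr {V : Type*} [Fintype V] (T : Tournament V) : ℕ :=
  (Finset.univ.filter fun X : Finset V => (T.induce X).IsTransitive).sup Finset.card

open Classical in
/-- The directed density `d(X, Y) = e_{X,Y} / (|X| |Y|)`, where `e_{X,Y}` is the number of edges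
`(x, y)` with `x ∈ X` and `y ∈ Y`. -/
noncomputable def density {V : Type*} (T : Tournament V) (X Y : Finset V) : ℝ :=
  ((Rel.interedges T.Adj X Y).card : ℝ) / ((X.card : ℝ) * (Y.card : ℝ))

/-- `T` is `ε`-critical: `tr(T) < |T|^ε`, but `tr(S) ≥ |S|^ε` for every proper subtournament `S`. -/
def IsCritical {V : Type*} [Fintype V] (T : Tournament V) (ε : ℝ) : Prop :=
  (T.tr : ℝ) < (Fintype.card V : ℝ) ^ ε ∧
    ∀ X : Finset V, X ≠ Finset.univ → (X.card : ℝ) ^ ε ≤ ((T.induce X).tr : ℝ)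

/-- `(A 0, …, A (k-1))` is a `(c, l, w)`-structure in `T`, for a `{0,1}`-vector `w` of length `k`. -/
structure IsStructure {V : Type*} [Fintype V] (T : Tournament V) (c l : ℝ) {k : ℕ}
    (w : Fin k → Fin 2) (A : Fin k → Finset V) : Prop where
  disjoint : ∀ i j, i ≠ j → Disjoint (A i) (A j)
  linear : ∀ i, w i = 0 → c * (Fintype.card V : ℝ) ≤ ((A i).card : ℝ)
  transitive : ∀ i, w i = 1 →
    (T.induce (A i)).IsTransitive ∧ c * (T.tr : ℝ) ≤ ((A i).card : ℝ)
  dense : ∀ i j, i < j → 1 - l ≤ T.density (A i) (A j)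

/-- A smooth `(c, l, w)`-structure: the density bounds hold from and to every single vertex. -/
structure IsSmoothStructure {V : Type*} [Fintype V] (T : Tournament V) (c l : ℝ) {k : ℕ}
    (w : Fin k → Fin 2) (A : Fin k → Finset V) : Prop extends T.IsStructure c l w A where
  dense_out : ∀ i j, i < j → ∀ v ∈ A i, 1 - l ≤ T.density {v} (A j)
  dense_in : ∀ i j, i < j → ∀ v ∈ A j, 1 - l ≤ T.density (A i) {v}

end Tournament

namespace Tournament

open Finset Classical

/-- Each vertex of `X` is `r`-related to all but a proportion `l` of `Y`, and each vertex of `Y` is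
`r`-related from all but a proportion `l` of `X`. -/
def AlmostComplete {V : Type*} (r : V → V → Prop) (l : ℝ) (X Y : Finset V) : Prop :=
  (∀ x ∈ X, (#{y ∈ Y | ¬ r x y} : ℝ) ≤ l * #Y) ∧ ∀ y ∈ Y, (#{x ∈ X | ¬ r x y} : ℝ) ≤ l * #X

theorem AlmostComplete.flip {V : Type*} {r : V → V → Prop} {l : ℝ} {X Y : Finset V}
    (h : AlmostComplete r l X Y) : AlmostComplete (flip r) l Y X :=
  ⟨h.2, h.1⟩

theorem card_filter_le_of_subset {V : Type*} {p : V → Prop} [DecidablePred p] {l a : ℝ} {Y Y' : Finset V}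
    (hl : 0 ≤ l) (hY : Y' ⊆ Y) (ha : (#Y : ℝ) ≤ a * #Y')
    (h : (#{y ∈ Y | p y} : ℝ) ≤ l * #Y) : (#{y ∈ Y' | p y} : ℝ) ≤ a * l * #Y' := by
  have h1 : (#{y ∈ Y' | p y} : ℝ) ≤ #{y ∈ Y | p y} := by
    exact_mod_cast card_le_card (filter_subset_filter _ hY)
  have h2 := mul_le_mul_of_nonneg_left ha hl
  linarith

theorem AlmostComplete.mono {V : Type*} {r : V → V → Prop} {l a : ℝ} {X Y X' Y' : Finset V}
    (h : AlmostComplete r l X Y) (hl : 0 ≤ l) (hX : X' ⊆ X) (hY : Y' ⊆ Y)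
    (hXa : (#X : ℝ) ≤ a * #X') (hYa : (#Y : ℝ) ≤ a * #Y') :
    AlmostComplete r (a * l) X' Y' :=
  ⟨fun x hx => card_filter_le_of_subset hl hY hYa (h.1 x (hX hx)),
    fun y hy => card_filter_le_of_subset hl hX hXa (h.2 y (hY hy))⟩

theorem AlmostComplete.mono_left {V : Type*} {r : V → V → Prop} {l l' : ℝ} {X Y : Finset V}
    (h : AlmostComplete r l X Y) (hl : l ≤ l') : AlmostComplete r l' X Y :=
  ⟨fun x hx => (h.1 x hx).trans (mul_le_mul_of_nonneg_right hl (Nat.cast_nonneg _)),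
    fun y hy => (h.2 y hy).trans (mul_le_mul_of_nonneg_right hl (Nat.cast_nonneg _))⟩

/-- A one-sided degree condition becomes two-sided after halving the other side. -/
theorem exists_almostComplete_right {V : Type*} {r : V → V → Prop} {l : ℝ} (hl : 0 < l)
    {X Y : Finset V} (h : ∀ x ∈ X, (#{y ∈ Y | ¬ r x y} : ℝ) ≤ l * #Y) :
    ∃ Y' ⊆ Y, (#Y : ℝ) ≤ 2 * #Y' ∧ AlmostComplete r (2 * l) X Y' := by
  set Y' := {y ∈ Y | (#{x ∈ X | ¬ r x y} : ℝ) ≤ 2 * l * #X} with hY'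
  set Z := {y ∈ Y | ¬ (#{x ∈ X | ¬ r x y} : ℝ) ≤ 2 * l * #X} with hZ
  have hsub : Y' ⊆ Y := filter_subset _ _
  have hcard : (#Y' : ℝ) + #Z = #Y := by
    exact_mod_cast card_filter_add_card_filter_not (s := Y) _
  have hhalf : (#Y : ℝ) ≤ 2 * #Y' := by
    rcases X.eq_empty_or_nonempty with rfl | hX
    · have : Z = ∅ := by simp [hZ]
      rw [this] at hcard
      simp only [card_empty, Nat.cast_zero, add_zero] at hcard
      rw [← hcard]
      linarith [(Nat.cast_nonneg (#Y') : (0 : ℝ) ≤ #Y')]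
    have hXpos : (0 : ℝ) < #X := by exact_mod_cast hX.card_pos
    have hdouble : (∑ x ∈ X, #{y ∈ Y | ¬ r x y}) = ∑ y ∈ Y, #{x ∈ X | ¬ r x y} :=
      sum_card_bipartiteAbove_eq_sum_card_bipartiteBelow fun x y => ¬ r x y
    have hup : ((∑ x ∈ X, #{y ∈ Y | ¬ r x y} : ℕ) : ℝ) ≤ #X * (l * #Y) := by
      push_cast
      calc _ ≤ ∑ _x ∈ X, l * (#Y : ℝ) := sum_le_sum h
        _ = _ := by simp
    have hlow : (#Z : ℝ) * (2 * l * #X) ≤ ((∑ y ∈ Y, #{x ∈ X | ¬ r x y} : ℕ) : ℝ) := by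
      push_cast
      calc (#Z : ℝ) * (2 * l * #X) = ∑ _y ∈ Z, 2 * l * (#X : ℝ) := by simp
        _ ≤ ∑ y ∈ Z, (#{x ∈ X | ¬ r x y} : ℝ) :=
          sum_le_sum fun y hy => (not_le.1 (mem_filter.1 hy).2).le
        _ ≤ _ := sum_le_sum_of_subset_of_nonneg (filter_subset _ _) fun _ _ _ => by positivity
    rw [hdouble] at hup
    have h3 : (l * #X) * (2 * #Z) ≤ (l * #X) * #Y := by linarith
    have := le_of_mul_le_mul_left h3 (by positivity)
    linarith
  refine ⟨Y', hsub, hhalf, fun x hx => ?_, fun y hy => (mem_filter.1 hy).2⟩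
  exact card_filter_le_of_subset hl.le hsub hhalf (h x hx)

theorem AlmostComplete.exists_right {V : Type*} {r : V → V → Prop} {l : ℝ} (hl : 0 < l)
    {X Y G : Finset V} (h : AlmostComplete r l X Y) (hG : G ⊆ X) :
    ∃ Y' ⊆ Y, (#Y : ℝ) ≤ 2 * #Y' ∧ AlmostComplete r (2 * l) G Y' :=
  exists_almostComplete_right hl fun x hx => h.1 x (hG hx)

theorem AlmostComplete.exists_left {V : Type*} {r : V → V → Prop} {l : ℝ} (hl : 0 < l)
    {X Y G : Finset V} (h : AlmostComplete r l X Y) (hG : G ⊆ Y) :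
    ∃ X' ⊆ X, (#X : ℝ) ≤ 2 * #X' ∧ AlmostComplete r (2 * l) X' G := by
  obtain ⟨X', h1, h2, h3⟩ := h.flip.exists_right hl hG
  exact ⟨X', h1, h2, h3.flip⟩

theorem not_adj_iff {V : Type*} (T : Tournament V) {v w : V} (h : v ≠ w) :
    ¬ T.Adj v w ↔ T.Adj w v := by
  have := T.exactly_one v w h
  unfold Xor at this
  tauto

/-- Greedy embedding: if no two large sets are almost completely joined in one direction, then
every tournament embeds with prescribed large candidate sets. -/
theorem exists_hom_of_degree {U V : Type*} [Nonempty V] (S : Tournament U) (T : Tournament V)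
    {l : ℝ} (hl : 0 < l) (hl1 : l ≤ 1) {m K : ℕ} (hm : 0 < m)
    {X : Finset V} (H : ∀ A ⊆ X, ∀ B ⊆ X, m ≤ #A → m ≤ #B →
      (∃ v ∈ A, l * #B ≤ (#{y ∈ B | T.Adj v y} : ℝ)) ∧
      ∃ v ∈ A, l * #B ≤ (#{y ∈ B | T.Adj y v} : ℝ)) (Q : Finset U) :
    #Q ≤ K → ∀ F : U → Finset V, (∀ u ∈ Q, F u ⊆ X) → (∀ u ∈ Q, (K * m : ℝ) ≤ l ^ #Q * #(F u)) →
      ∃ φ : U → V, (∀ u ∈ Q, φ u ∈ F u) ∧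
        ∀ u ∈ Q, ∀ u' ∈ Q, S.Adj u u' → T.Adj (φ u) (φ u') := by
  induction Q using Finset.induction_on with
  | empty => exact fun _ F _ _ => ⟨fun _ => Classical.arbitrary V, by simp, by simp⟩
  | insert a Q haQ ih =>
    intro hK F hFX hF
    rw [card_insert_of_notMem haQ] at hK
    have hbig : ∀ u ∈ insert a Q, K * m ≤ #(F u) := fun u hu => by
      have h1 := hF u hu
      have h2 : l ^ #(insert a Q) * (#(F u) : ℝ) ≤ 1 * #(F u) :=
        mul_le_mul_of_nonneg_right (pow_le_one₀ hl.le hl1) (Nat.cast_nonneg _)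
      have : ((K * m : ℕ) : ℝ) ≤ (#(F u) : ℕ) := by push_cast; linarith
      exact_mod_cast this
    have hm_le : ∀ u ∈ insert a Q, m ≤ #(F u) := fun u hu =>
      le_trans (Nat.le_mul_of_pos_left m (by omega)) (hbig u hu)
    let N : V → U → Finset V := fun v u =>
      if S.Adj a u then {y ∈ F u | T.Adj v y} else {y ∈ F u | T.Adj y v}
    have hNF : ∀ v u, N v u ⊆ F u := fun v u => by
      simp only [N]
      split_ifs <;> exact filter_subset _ _
    let bad : U → Finset V := fun u => {v ∈ F a | (#(N v u) : ℝ) < l * #(F u)}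
    have hbad : ∀ u ∈ Q, #(bad u) ≤ m := fun u hu => by
      by_contra! hlt
      obtain ⟨⟨v, hv, hv'⟩, v', hw, hw'⟩ :=
        H (bad u) ((filter_subset _ _).trans (hFX a (mem_insert_self _ _))) (F u)
          (hFX u (mem_insert_of_mem hu)) hlt.le (hm_le u (mem_insert_of_mem hu))
      by_cases hS : S.Adj a u
      · have := (mem_filter.1 hv).2
        simp only [N, if_pos hS] at this
        linarith
      · have := (mem_filter.1 hw).2
        simp only [N, if_neg hS] at this
        linarith
    have hcard : #(Q.biUnion bad) < #(F a) := by
      calc #(Q.biUnion bad) ≤ #Q * m := card_biUnion_le_card_mul _ _ _ hbad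
        _ < (#Q + 1) * m := by nlinarith
        _ ≤ K * m := Nat.mul_le_mul_right _ hK
        _ ≤ _ := hbig a (mem_insert_self _ _)
    obtain ⟨v, hvF, hv⟩ := exists_mem_notMem_of_card_lt_card hcard
    have hN : ∀ u ∈ Q, l * #(F u) ≤ (#(N v u) : ℝ) := fun u hu => by
      by_contra! hlt
      exact hv (mem_biUnion.2 ⟨u, hu, mem_filter.2 ⟨hvF, hlt⟩⟩)
    obtain ⟨φ, hφ, hadj⟩ := ih (by omega) (N v) (fun u hu => (hNF v u).trans (hFX u (mem_insert_of_mem hu))) fun u hu => by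
      have h1 := hF u (mem_insert_of_mem hu)
      rw [card_insert_of_notMem haQ, pow_succ, mul_assoc] at h1
      exact h1.trans (mul_le_mul_of_nonneg_left (hN u hu) (by positivity))
    have hne : ∀ u ∈ Q, u ≠ a := fun u hu h => haQ (h ▸ hu)
    have hout : ∀ u ∈ Q, S.Adj a u → φ u ∈ F u ∧ T.Adj v (φ u) := fun u hu hS => by
      have := hφ u hu
      simp only [N, if_pos hS] at this
      exact mem_filter.1 this
    have hin : ∀ u ∈ Q, ¬ S.Adj a u → φ u ∈ F u ∧ T.Adj (φ u) v := fun u hu hS => by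
      have := hφ u hu
      simp only [N, if_neg hS] at this
      exact mem_filter.1 this
    refine ⟨Function.update φ a v, fun u hu => ?_, fun u hu u' hu' hS => ?_⟩
    · rcases mem_insert.1 hu with rfl | hu
      · simpa using hvF
      · rw [Function.update_of_ne (hne u hu)]
        by_cases hS : S.Adj a u
        exacts [(hout u hu hS).1, (hin u hu hS).1]
    · rcases mem_insert.1 hu with hu | h1 <;> rcases mem_insert.1 hu' with hu' | h2
      · subst hu hu'
        exact absurd hS (S.loopless _)
      · subst hu
        rw [Function.update_self, Function.update_of_ne (hne u' h2)]
        exact (hout u' h2 hS).2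
      · subst hu'
        rw [Function.update_self, Function.update_of_ne (hne u h1)]
        exact (hin u h1 ((S.not_adj_iff (hne u h1).symm).2 hS)).2
      · rw [Function.update_of_ne (hne u h1), Function.update_of_ne (hne u' h2)]
        exact hadj u h1 u' h2 hS

theorem contains_of_hom {U V : Type*} {S : Tournament U} {T : Tournament V} (φ : U → V)
    (h : ∀ u u', S.Adj u u' → T.Adj (φ u) (φ u')) : T.Contains S := by
  have hinj : Function.Injective φ := fun u u' he => by
    by_contra hne
    by_cases hS : S.Adj u u'
    · exact T.loopless _ (he ▸ h _ _ hS)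
    · exact T.loopless _ (he ▸ h _ _ ((S.not_adj_iff hne).1 hS))
  refine ⟨⟨⟨φ, hinj⟩, fun {u u'} => ⟨fun hT => ?_, h u u'⟩⟩⟩
  change T.Adj (φ u) (φ u') at hT
  by_contra hS
  rcases eq_or_ne u u' with rfl | hne
  · exact T.loopless _ hT
  · exact (T.not_adj_iff fun he => hne (hinj he).symm).2 hT (h _ _ ((S.not_adj_iff hne).1 hS))

/-- A sparse one-sided pair of large sets contains a large disjoint almost complete pair in the
opposite direction. -/
theorem exists_disjoint_almostComplete {V : Type*} {r : V → V → Prop}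
    (hr : ∀ v w, v ≠ w → ¬ r w v → r v w) {l : ℝ} (hl : 0 < l) {q : ℕ} {A B : Finset V}
    (hA : 2 * q ≤ #A) (hB : 2 * q ≤ #B) (h : ∀ v ∈ A, (#{y ∈ B | r v y} : ℝ) ≤ l * #B) :
    ∃ A' ⊆ A, ∃ B' ⊆ B, Disjoint A' B' ∧ (q : ℝ) ≤ 2 * #A' ∧ (q : ℝ) ≤ 2 * #B' ∧
      AlmostComplete r (4 * l) B' A' := by
  obtain ⟨A', hA', hq⟩ := exists_subset_card_eq (show q ≤ #A by omega)
  have hsd : #B - q ≤ #(B \ A') := hq ▸ le_card_sdiff A' B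
  have hsd' : (#B : ℝ) ≤ 2 * #(B \ A') := by
    have : #B ≤ 2 * #(B \ A') := by omega
    exact_mod_cast this
  have h' : ∀ x ∈ A', (#{y ∈ B \ A' | ¬ flip r x y} : ℝ) ≤ 2 * l * #(B \ A') := fun x hx => by
    have hle := card_filter_le_of_subset hl.le sdiff_subset hsd' (h x (hA' hx))
    refine le_trans ?_ hle
    refine Nat.cast_le.2 (card_le_card fun y hy => ?_)
    rw [mem_filter] at hy ⊢
    exact ⟨hy.1, hr x y (fun he => (mem_sdiff.1 hy.1).2 (he ▸ hx)) hy.2⟩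
  obtain ⟨B', hB', hcard, hac⟩ := exists_almostComplete_right (by positivity) h'
  refine ⟨A', hA', B', hB'.trans sdiff_subset, ?_, ?_, ?_, ?_⟩
  · exact disjoint_of_subset_right hB' disjoint_sdiff
  · rw [hq]
    linarith [(Nat.cast_nonneg q : (0 : ℝ) ≤ q)]
  · have : q ≤ #(B \ A') := by omega
    exact le_trans (by exact_mod_cast this) hcard
  · have := hac.flip
    rw [show 2 * (2 * l) = 4 * l by ring] at this
    exact this

/-- Every large set of vertices of an `S`-free tournament contains a linear almost complete pair. -/
theorem exists_almostComplete_of_isFree {U : Type*} [Fintype U] (S : Tournament U) {l : ℝ}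
    (hl : 0 < l) : ∃ c : ℝ, 0 < c ∧ ∃ N : ℕ, ∀ {V : Type*} (T : Tournament V), T.IsFree S →
      ∀ X : Finset V, N ≤ #X → ∃ A ⊆ X, ∃ B ⊆ X, Disjoint A B ∧ c * #X ≤ #A ∧ c * #X ≤ #B ∧
        AlmostComplete T.Adj l A B := by
  set h := Fintype.card U
  set d : ℝ := min (l / 4) 1 with hd
  have hd0 : 0 < d := lt_min (by positivity) one_pos
  have hd1 : d ≤ 1 := min_le_right _ _
  have hdl : 4 * d ≤ l := by linarith [min_le_left (l / 4) 1]
  set a : ℝ := d ^ h / (h + 1) with ha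
  have ha0 : 0 < a := by positivity
  obtain ⟨N, hN⟩ := exists_nat_ge (4 / a)
  refine ⟨a / 8, by positivity, N, fun {V} T hT X hX => ?_⟩
  have hNX : 4 ≤ a * #X := by
    have : 4 / a ≤ #X := hN.trans (by exact_mod_cast hX)
    rwa [div_le_iff₀' ha0] at this
  have hXne : X.Nonempty := by
    rw [nonempty_iff_ne_empty]
    rintro rfl
    norm_num at hNX
  have : Nonempty V := ⟨hXne.choose⟩
  set q := ⌊a * #X / 2⌋₊ with hq
  have hq1 : (q : ℝ) ≤ a * #X / 2 := Nat.floor_le (by positivity)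
  have hq2 : a * #X / 2 < q + 1 := Nat.lt_floor_add_one _
  have hq4 : a * #X / 4 ≤ q := by linarith
  have hq0 : 0 < q := by
    have : (0 : ℝ) < q := by linarith
    exact_mod_cast this
  have hlarge : ((h + 1 : ℕ) * (2 * q : ℕ) : ℝ) ≤ d ^ h * #X := by
    have : (2 * q : ℝ) ≤ d ^ h / (h + 1) * #X := by linarith
    rw [div_mul_eq_mul_div, le_div_iff₀' (by positivity)] at this
    push_cast
    exact this
  have hsparse : ∃ A ⊆ X, ∃ B ⊆ X, 2 * q ≤ #A ∧ 2 * q ≤ #B ∧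
      ((∀ v ∈ A, (#{y ∈ B | T.Adj v y} : ℝ) ≤ d * #B) ∨
        ∀ v ∈ A, (#{y ∈ B | T.Adj y v} : ℝ) ≤ d * #B) := by
    by_contra! hcon
    obtain ⟨φ, -, hφ⟩ := S.exists_hom_of_degree T hd0 hd1 (m := 2 * q) (K := h + 1) (by omega)
      (X := X) (fun A hA B hB hAq hBq => by
        obtain ⟨⟨v, hv, hv'⟩, w, hw, hw'⟩ := hcon A hA B hB hAq hBq
        exact ⟨⟨v, hv, hv'.le⟩, w, hw, hw'.le⟩) univ (Nat.le_succ h) (fun _ => X)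
      (fun _ _ => subset_rfl) (fun _ _ => hlarge)
    exact hT (contains_of_hom φ fun u u' => hφ u (mem_univ u) u' (mem_univ u'))
  obtain ⟨A, hA, B, hB, hAq, hBq, hAB | hAB⟩ := hsparse
  · obtain ⟨A', hA', B', hB', hdis, hA'q, hB'q, hac⟩ := exists_disjoint_almostComplete
      (fun v w hvw => (T.not_adj_iff hvw.symm).1) hd0 hAq hBq hAB
    refine ⟨B', hB'.trans hB, A', hA'.trans hA, hdis.symm, by linarith, by linarith, ?_⟩
    exact hac.mono_left hdl
  · obtain ⟨A', hA', B', hB', hdis, hA'q, hB'q, hac⟩ := exists_disjoint_almostComplete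
      (r := flip T.Adj) (fun v w hvw => (T.not_adj_iff hvw).1) hd0 hAq hBq hAB
    refine ⟨A', hA'.trans hA, B', hB'.trans hB, hdis, by linarith, by linarith, ?_⟩
    exact hac.flip.mono_left hdl

/-- Every large set of vertices of an `S`-free tournament contains a chain of linear sets, each
almost complete to the later ones. -/
theorem exists_chain_of_isFree {U : Type*} [Fintype U] (S : Tournament U) (k : ℕ) {l : ℝ}
    (hl : 0 < l) : ∃ c : ℝ, 0 < c ∧ c ≤ 1 ∧ ∃ N : ℕ, ∀ {V : Type*} (T : Tournament V),
      T.IsFree S → ∀ X : Finset V, N ≤ #X → ∃ A : Fin k → Finset V, (∀ i, A i ⊆ X) ∧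
        (∀ i, c * #X ≤ #(A i)) ∧
        ∀ i j, i < j → Disjoint (A i) (A j) ∧ AlmostComplete T.Adj l (A i) (A j) := by
  induction k with
  | zero =>
    exact ⟨1, one_pos, le_rfl, 0, fun T _ X _ =>
      ⟨fun _ => ∅, fun i => i.elim0, fun i => i.elim0, fun i => i.elim0⟩⟩
  | succ k ih =>
    obtain ⟨c, hc, hc1, N, H⟩ := ih
    obtain ⟨b, hb, M, HP⟩ := exists_almostComplete_of_isFree S (l := c * l) (by positivity)
    obtain ⟨M', hM'⟩ := exists_nat_ge (N / b)
    refine ⟨min (c * b) 1, by positivity, min_le_right _ _, max M M', fun {V} T hT X hX => ?_⟩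
    obtain ⟨A, hA, B, hB, hAB, hAX, hBX, hac⟩ := HP T hT X (le_trans (le_max_left _ _) hX)
    have hN : N ≤ #B := by
      have h1 : N / b ≤ #X := hM'.trans (by exact_mod_cast (le_max_right _ _).trans hX)
      rw [div_le_iff₀' hb] at h1
      exact_mod_cast h1.trans hBX
    obtain ⟨C, hCB, hC, hCC⟩ := H T hT B hN
    have hbX : 0 ≤ b * (#X : ℝ) := by positivity
    have hmin : min (c * b) 1 * (#X : ℝ) ≤ c * (b * #X) := by
      rw [← mul_assoc]
      exact mul_le_mul_of_nonneg_right (min_le_left _ _) (Nat.cast_nonneg _)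
    refine ⟨Fin.cons A C, fun i => ?_, fun i => ?_, fun i j hij => ?_⟩
    · cases i using Fin.cases with
      | zero => exact hA
      | succ i => exact (hCB i).trans hB
    · cases i using Fin.cases with
      | zero =>
        simp only [Fin.cons_zero]
        have := mul_le_mul_of_nonneg_right hc1 hbX
        linarith
      | succ i =>
        simp only [Fin.cons_succ]
        have := mul_le_mul_of_nonneg_left hBX hc.le
        linarith [hC i]
    · cases j using Fin.cases with
      | zero => exact absurd hij (Fin.not_lt_zero i)
      | succ j =>
        cases i using Fin.cases with
        | zero =>
          simp only [Fin.cons_zero, Fin.cons_succ]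
          refine ⟨disjoint_of_subset_right (hCB j) hAB, ?_⟩
          have hc' : 1 ≤ c⁻¹ := (one_le_inv₀ hc).2 hc1
          have := hac.mono (a := c⁻¹) (by positivity) subset_rfl (hCB j)
            (le_mul_of_one_le_left (Nat.cast_nonneg _) hc')
            ((le_inv_mul_iff₀ hc).2 (hC j))
          rwa [inv_mul_cancel_left₀ hc.ne'] at this
        | succ i => exact hCC i j (Fin.succ_lt_succ_iff.1 hij)

theorem IsTransitive.of_hom {V W : Type*} {T : Tournament V} {H : Tournament W}
    (h : T.IsTransitive) (f : W → V) (hf : ∀ a b, H.Adj a b → T.Adj (f a) (f b)) :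
    H.IsTransitive :=
  fun v hv => h (f v) (Relation.TransGen.lift f hf v v hv)

theorem IsTransitive.mono {V : Type*} {T : Tournament V} {X Y : Finset V}
    (h : (T.induce Y).IsTransitive) (hXY : X ⊆ Y) : (T.induce X).IsTransitive :=
  h.of_hom (fun v => ⟨v, hXY v.2⟩) fun _ _ h => h

theorem exists_card_eq_tr {V : Type*} [Fintype V] (T : Tournament V) :
    ∃ X : Finset V, (T.induce X).IsTransitive ∧ #X = T.tr := by
  have hne : (univ.filter fun X : Finset V => (T.induce X).IsTransitive).Nonempty :=
    ⟨∅, mem_filter.2 ⟨mem_univ _, fun v => absurd v.2 (notMem_empty _)⟩⟩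
  obtain ⟨X, hX, h⟩ := exists_mem_eq_sup _ hne Finset.card
  exact ⟨X, (mem_filter.1 hX).2, h.symm⟩

theorem IsTransitive.card_le_tr {V : Type*} [Fintype V] {T : Tournament V} {X : Finset V}
    (h : (T.induce X).IsTransitive) : #X ≤ T.tr :=
  le_sup (f := Finset.card) (mem_filter.2 ⟨mem_univ X, h⟩)

theorem exists_subset_card_eq_tr {V : Type*} (T : Tournament V) (X : Finset V) :
    ∃ G ⊆ X, (T.induce G).IsTransitive ∧ #G = (T.induce X).tr := by
  obtain ⟨Y, hY, h⟩ := (T.induce X).exists_card_eq_tr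
  refine ⟨Y.map (Function.Embedding.subtype _), fun v hv => ?_, ?_, by rw [card_map, h]⟩
  · obtain ⟨y, -, rfl⟩ := mem_map.1 hv
    exact y.2
  · have hmem : ∀ v : (Y.map (Function.Embedding.subtype (· ∈ X)) : Finset V),
        ∃ y : Y, (y : V) = v := fun v => by
      obtain ⟨y, hy, h⟩ := mem_map.1 v.2
      exact ⟨⟨y, hy⟩, h⟩
    choose f hf using hmem
    refine hY.of_hom f fun a b hab => ?_
    change T.Adj (f a : V) (f b : V)
    rw [hf, hf]
    exact hab

theorem induce_pair_isTransitive {V : Type*} (T : Tournament V) {a b : V} (hab : T.Adj a b) :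
    (T.induce {a, b}).IsTransitive := by
  intro v hv
  have hlt := Relation.TransGen.lift (p := (· < · : ℕ → ℕ → Prop))
    (fun x : ({a, b} : Finset V) => if (x : V) = a then 0 else 1) (fun x y hxy => ?_) v v hv
  · rw [Relation.transGen_eq_self] at hlt
    exact lt_irrefl _ hlt
  · have hne : b ≠ a := fun h => T.loopless a (h ▸ hab)
    have hba : ¬ T.Adj b a := (T.not_adj_iff hne).2 hab
    obtain ⟨x, hx⟩ := x
    obtain ⟨y, hy⟩ := y
    change T.Adj x y at hxy
    rw [mem_insert, mem_singleton] at hx hy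
    rcases hx with rfl | rfl <;> rcases hy with rfl | rfl
    · exact absurd hxy (T.loopless _)
    · simp [Function.onFun, hne]
    · exact absurd hxy hba
    · exact absurd hxy (T.loopless _)

theorem induce_singleton_isTransitive {V : Type*} (T : Tournament V) (a : V) :
    (T.induce {a}).IsTransitive := by
  intro v hv
  obtain ⟨w, hw, -⟩ := Relation.TransGen.head'_iff.1 hv
  exact (T.induce {a}).loopless v (Subsingleton.elim w v ▸ hw)

theorem IsCritical.nonempty {V : Type*} [Fintype V] {T : Tournament V} {ε : ℝ} (hε : 0 < ε)
    (h : T.IsCritical ε) : Nonempty V := by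
  by_contra hV
  rw [not_nonempty_iff] at hV
  have := h.1
  rw [Fintype.card_eq_zero, Nat.cast_zero, Real.zero_rpow hε.ne'] at this
  exact absurd this (not_lt.2 (Nat.cast_nonneg _))

theorem tr_pos {V : Type*} [Fintype V] [Nonempty V] (T : Tournament V) : 0 < T.tr :=
  (T.induce_singleton_isTransitive (Classical.arbitrary V)).card_le_tr

theorem IsCritical.lt_card {V : Type*} [Fintype V] {T : Tournament V} {ε : ℝ} (hε : 0 < ε)
    (h : T.IsCritical ε) {N : ℕ} (hN : ε * N ≤ 1) : N < Fintype.card V := by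
  have := h.nonempty hε
  by_contra! hle
  have htwo : 2 ≤ T.tr := by
    rcases subsingleton_or_nontrivial V with hV | hV
    · have h1 := h.1
      have h2 := T.tr_pos
      rw [Fintype.card_eq_one_iff_nonempty_unique.2 ⟨uniqueOfSubsingleton (Classical.arbitrary V)⟩, Nat.cast_one,
        Real.one_rpow] at h1
      have : (1 : ℝ) ≤ T.tr := by exact_mod_cast h2
      linarith
    · obtain ⟨a, b, hab⟩ := exists_pair_ne V
      by_cases hadj : T.Adj a b
      · exact card_pair hab ▸ (T.induce_pair_isTransitive hadj).card_le_tr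
      · exact card_pair hab.symm ▸
          (T.induce_pair_isTransitive ((T.not_adj_iff hab).1 hadj)).card_le_tr
  have h1 : (Fintype.card V : ℝ) ^ ε ≤ 2 := by
    calc (Fintype.card V : ℝ) ^ ε ≤ ((2 : ℝ) ^ (N : ℝ)) ^ ε := by
          refine Real.rpow_le_rpow (Nat.cast_nonneg _) ?_ hε.le
          rw [Real.rpow_natCast]
          exact_mod_cast hle.trans Nat.lt_two_pow_self.le
      _ = (2 : ℝ) ^ (N * ε) := (Real.rpow_mul (by norm_num) _ _).symm
      _ ≤ (2 : ℝ) ^ (1 : ℝ) := Real.rpow_le_rpow_of_exponent_le (by norm_num) (by linarith)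
      _ = 2 := Real.rpow_one 2
  have h2 : (2 : ℝ) ≤ T.tr := by exact_mod_cast htwo
  linarith [h.1]

theorem IsCritical.exists_subset_isTransitive {V : Type*} [Fintype V] {T : Tournament V}
    {ε c : ℝ} (hε : 0 < ε) (hε1 : ε ≤ 1) (hc : 0 < c) (hc1 : c ≤ 1) (h : T.IsCritical ε)
    {X : Finset V} (hX : c * Fintype.card V ≤ #X) :
    ∃ G ⊆ X, (T.induce G).IsTransitive ∧ c * T.tr ≤ #G := by
  by_cases hXu : X = univ
  · obtain ⟨G, hG, hcard⟩ := T.exists_card_eq_tr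
    refine ⟨G, hXu ▸ subset_univ G, hG, ?_⟩
    rw [hcard]
    exact mul_le_of_le_one_left (Nat.cast_nonneg _) hc1
  · obtain ⟨G, hGX, hG, hcard⟩ := T.exists_subset_card_eq_tr X
    refine ⟨G, hGX, hG, ?_⟩
    rw [hcard]
    calc c * (T.tr : ℝ) ≤ c ^ ε * (Fintype.card V : ℝ) ^ ε :=
          mul_le_mul (Real.self_le_rpow_of_le_one hc.le hc1 hε1) h.1.le (Nat.cast_nonneg _)
            (by positivity)
      _ = (c * Fintype.card V) ^ ε := (Real.mul_rpow hc.le (Nat.cast_nonneg _)).symm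
      _ ≤ (#X : ℝ) ^ ε := Real.rpow_le_rpow (by positivity) hX hε.le
      _ ≤ _ := h.2 X hXu

/-- Replacing the linear sets indexed by `P` with transitive sets, at the cost of halving the size
constant and doubling the error at each step. -/
theorem IsCritical.exists_chain_replace {V : Type*} [Fintype V] {T : Tournament V} {ε : ℝ}
    (hε : 0 < ε) (hε1 : ε ≤ 1) (h : T.IsCritical ε) {k : ℕ} {c l : ℝ} (hc : 0 < c) (hc1 : c ≤ 1)
    (hl : 0 < l) {A : Fin k → Finset V} (hA : ∀ i, c * Fintype.card V ≤ #(A i))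
    (hAA : ∀ i j, i < j → Disjoint (A i) (A j) ∧ AlmostComplete T.Adj l (A i) (A j))
    (P : Finset (Fin k)) : ∃ B : Fin k → Finset V,
      (∀ i ∉ P, c / 2 ^ #P * Fintype.card V ≤ #(B i)) ∧
      (∀ i ∈ P, (T.induce (B i)).IsTransitive ∧ c / 2 ^ #P * T.tr ≤ #(B i)) ∧
      ∀ i j, i < j → Disjoint (B i) (B j) ∧ AlmostComplete T.Adj (2 ^ #P * l) (B i) (B j) := by
  induction P using Finset.induction_on with
  | empty => exact ⟨A, by simpa using hA, by simp, by simpa using hAA⟩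
  | insert p P hp ih =>
    obtain ⟨B, hB0, hB1, hBB⟩ := ih
    rw [card_insert_of_notMem hp]
    set b := c / 2 ^ #P with hb
    set m := 2 ^ #P * l with hm
    have hb' : c / 2 ^ (#P + 1) = b / 2 := by rw [hb, pow_succ, div_div]
    have hm' : 2 ^ (#P + 1) * l = 2 * m := by rw [hm, pow_succ]; ring
    have hb0 : 0 < b := by positivity
    have hm0 : 0 < m := by positivity
    have hb1 : b ≤ 1 := (div_le_self hc.le (one_le_pow₀ (by norm_num))).trans hc1
    rw [hb', hm']
    obtain ⟨G, hG, hGt, hGc⟩ := h.exists_subset_isTransitive hε hε1 hb0 hb1 (hB0 p hp)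
    have hstep : ∀ j, ∃ Y ⊆ B j, (#(B j) : ℝ) ≤ 2 * #Y ∧
        (p < j → AlmostComplete T.Adj (2 * m) G Y) ∧
        (j < p → AlmostComplete T.Adj (2 * m) Y G) := fun j => by
      rcases lt_trichotomy p j with hj | hj | hj
      · obtain ⟨Y, h1, h2, h3⟩ := (hBB p j hj).2.exists_right hm0 hG
        exact ⟨Y, h1, h2, fun _ => h3, fun h => absurd h hj.not_gt⟩
      · subst hj
        exact ⟨B p, subset_rfl, by linarith [(Nat.cast_nonneg #(B p) : (0 : ℝ) ≤ _)],
          fun h => absurd h (lt_irrefl _), fun h => absurd h (lt_irrefl _)⟩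
      · obtain ⟨Y, h1, h2, h3⟩ := (hBB j p hj).2.exists_left hm0 hG
        exact ⟨Y, h1, h2, fun h => absurd h hj.not_gt, fun _ => h3⟩
    choose Y hYB hYc hYr hYl using hstep
    have hsub : ∀ i, Function.update Y p G i ⊆ B i := fun i => by
      rcases eq_or_ne i p with rfl | hi
      · rwa [Function.update_self]
      · rw [Function.update_of_ne hi]
        exact hYB i
    refine ⟨Function.update Y p G, fun i hi => ?_, fun i hi => ?_, fun i j hij =>
      ⟨disjoint_of_subset_left (hsub i) (disjoint_of_subset_right (hsub j) (hBB i j hij).1), ?_⟩⟩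
    · rw [mem_insert, not_or] at hi
      rw [Function.update_of_ne hi.1]
      linarith [hYc i, hB0 i hi.2]
    · rcases eq_or_ne i p with rfl | hip
      · rw [Function.update_self]
        refine ⟨hGt, ?_⟩
        have : 0 ≤ b * (T.tr : ℝ) := by positivity
        linarith
      · rw [Function.update_of_ne hip]
        obtain ⟨h1, h2⟩ := hB1 i (mem_of_mem_insert_of_ne hi hip)
        exact ⟨h1.mono (hYB i), by linarith [hYc i]⟩
    · rcases eq_or_ne i p with rfl | hip
      · rw [Function.update_self, Function.update_of_ne hij.ne']
        exact hYr j hij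
      rcases eq_or_ne j p with rfl | hjp
      · rw [Function.update_self, Function.update_of_ne hij.ne]
        exact hYl i hij
      rw [Function.update_of_ne hip, Function.update_of_ne hjp]
      exact (hBB i j hij).2.mono hm0.le (hYB i) (hYB j) (hYc i) (hYc j)

theorem le_density_of_card_le {V : Type*} (T : Tournament V) {l : ℝ} {X Y : Finset V}
    (hX : X.Nonempty) (hY : Y.Nonempty)
    (h : ∀ x ∈ X, (#{y ∈ Y | ¬ T.Adj x y} : ℝ) ≤ l * #Y) : 1 - l ≤ T.density X Y := by
  have hX0 : (0 : ℝ) < #X := by exact_mod_cast hX.card_pos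
  have hY0 : (0 : ℝ) < #Y := by exact_mod_cast hY.card_pos
  rw [density, le_div_iff₀ (by positivity)]
  have hcard : #(Rel.interedges T.Adj X Y) = ∑ x ∈ X, #{y ∈ Y | T.Adj x y} := by
    rw [Rel.interedges, card_filter, sum_product]
    simp only [card_filter]
  rw [hcard]
  push_cast
  calc (1 - l) * ((#X : ℝ) * #Y) = ∑ _x ∈ X, (1 - l) * (#Y : ℝ) := by simp; ring
    _ ≤ _ := sum_le_sum fun x hx => by
      have h1 : (#{y ∈ Y | T.Adj x y} : ℝ) + #{y ∈ Y | ¬ T.Adj x y} = #Y := by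
        exact_mod_cast card_filter_add_card_filter_not (s := Y) _
      linarith [h x hx]

theorem le_density_singleton_right {V : Type*} (T : Tournament V) {l : ℝ} {X : Finset V} {y : V}
    (hX : X.Nonempty) (h : (#{x ∈ X | ¬ T.Adj x y} : ℝ) ≤ l * #X) :
    1 - l ≤ T.density X {y} := by
  have hX0 : (0 : ℝ) < #X := by exact_mod_cast hX.card_pos
  rw [density, le_div_iff₀ (by simpa using hX0)]
  have hcard : #(Rel.interedges T.Adj X {y}) = #{x ∈ X | T.Adj x y} := by
    rw [Rel.interedges, card_filter, sum_product, card_filter]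
    simp only [sum_singleton]
  have h1 : (#{x ∈ X | T.Adj x y} : ℝ) + #{x ∈ X | ¬ T.Adj x y} = #X := by
    exact_mod_cast card_filter_add_card_filter_not (s := X) _
  rw [hcard, card_singleton, Nat.cast_one, mul_one]
  linarith

end Tournament

theorem mainTheorem6 {U : Type*} [Fintype U] (S : Tournament U) {k : ℕ} (w : Fin k → Fin 2)
    (l₁ : ℝ) (hl₁_pos : 0 < l₁) (hl₁_lt : l₁ < 1 / 2) :
    ∃ ε₁ c₁ : ℝ, 0 < ε₁ ∧ 0 < c₁ ∧
      ∀ ε : ℝ, 0 < ε → ε < ε₁ →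
        ∀ {V : Type*} [Fintype V] (T : Tournament V), T.IsFree S → T.IsCritical ε →
          ∃ A : Fin k → Finset V, T.IsSmoothStructure c₁ l₁ w A := by
  set P : Finset (Fin k) := Finset.univ.filter fun i => w i = 1 with hP
  obtain ⟨c, hc, hc1, N, H⟩ := S.exists_chain_of_isFree k (l := l₁ / 2 ^ P.card) (by positivity)
  refine ⟨1 / (N + 1), c / 2 ^ P.card, by positivity, by positivity,
    fun ε hε hε1 V _ T hT hcrit => ?_⟩
  have hεN : ε * (N + 1) < 1 := (lt_div_iff₀ (by positivity)).1 hε1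
  have hεle : ε ≤ 1 := by nlinarith [(Nat.cast_nonneg N : (0 : ℝ) ≤ N)]
  have hNV : N < Fintype.card V := hcrit.lt_card hε (by linarith)
  have hV := hcrit.nonempty hε
  obtain ⟨A, -, hA, hAA⟩ := H T hT Finset.univ (by rw [Finset.card_univ]; exact hNV.le)
  obtain ⟨B, hB0, hB1, hBB⟩ := hcrit.exists_chain_replace hε hεle hc hc1 (by positivity)
    (fun i => by simpa using hA i) hAA P
  rw [mul_div_cancel₀ l₁ (by positivity : (2 : ℝ) ^ P.card ≠ 0)] at hBB
  have hne : ∀ i, (B i).Nonempty := fun i => by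
    have htr : (0 : ℝ) < T.tr := by exact_mod_cast T.tr_pos
    have hcV : (0 : ℝ) < Fintype.card V := by exact_mod_cast Fintype.card_pos
    have hpos : (0 : ℝ) < (B i).card := by
      by_cases hi : i ∈ P
      · exact lt_of_lt_of_le (by positivity) (hB1 i hi).2
      · exact lt_of_lt_of_le (by positivity) (hB0 i hi)
    exact Finset.card_pos.1 (by exact_mod_cast hpos)
  refine ⟨B, ⟨fun i j hij => ?_, fun i hi => ?_, fun i hi => ?_, fun i j hij => ?_⟩,
    fun i j hij v hv => ?_, fun i j hij v hv => ?_⟩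
  · rcases hij.lt_or_gt with hij | hij
    exacts [(hBB i j hij).1, (hBB j i hij).1.symm]
  · exact hB0 i (by simp [hP, hi])
  · exact hB1 i (by simp [hP, hi])
  · exact T.le_density_of_card_le (hne i) (hne j) (hBB i j hij).2.1
  · refine T.le_density_of_card_le (Finset.singleton_nonempty v) (hne j) fun x hx => ?_
    rw [Finset.mem_singleton.1 hx]
    exact (hBB i j hij).2.1 v hv
  · exact T.le_density_singleton_right (hne i) ((hBB i j hij).2.2 v hv)
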